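/- Let $n$ be a natural number, let $\mathbb{R}^n$ carry the dot product $\langle\cdot,\cdot\rangle$ and the Euclidean norm, let $F\subseteq\mathbb{R}^n$ be a nonempty closed bounded convex set, let $\Omega\subseteq\mathbb{R}^n$ be a nonempty closed set, and let $\bar y\in\Omega$. Define the minimal time function $\mathcal{T}_F(\cdot;\Omega):\mathbb{R}^n\to[0,\infty]$ by $$\mathcal{T}_F(x;\Omega):=\inf\{t\ge 0 \mid (x+tF)\cap\Omega\ne\emptyset\},\qquad \inf\emptyset:=\infty,$$ and let $F^+:=\{v\in\mathbb{R}^n \mid \langle v,x\rangle\ge 0 \text{ for all } x\in F\}$. For $a\in\Omega$, the Fréchet normal cone $\widehat N(a;\Omega)$ is the set of all $v\in\mathbb{R}^n$ such that for every $\varepsilon>0$ there is $\delta>0$ with $\langle v,x-a\rangle\le\varepsilon\|x-a\|$ for all $x\in\Omega$ with $\|x-a\|<\delta$. The limiting (Mordukhovich) normal cone $N(\bar y;\Omega)$ is the set of all $v\in\mathbb{R}^n$ for which there are sequences $x_k\in\Omega$ with $x_k\to\bar y$ and $v_k\in\widehat N(x_k;\Omega)$ with $v_k\to v$. If $N(\bar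 y;\Omega)\cap F^+=\{0\}$, then $\mathcal{T}_F(\cdot;\Omega)$ is Lipschitz continuous around $\bar y$, that is, there are a neighborhood $V$ of $\bar y$ on which $\mathcal{T}_F(\cdot;\Omega)$ is finite and a constant $\ell\in\mathbb{R}$ such that $|\mathcal{T}_F(x;\Omega)-\mathcal{T}_F(u;\Omega)|\le\ell\|x-u\|$ for all $x,u\in V$. Conversely, if $0\in F$ and $\mathcal{T}_F(\cdot;\Omega)$ is Lipschitz continuous around $\bar y$, then $N(\bar y;\Omega)\cap F^+=\{0\}$. -/

import Mathlib

open Filter Topology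
open scoped Pointwise

noncomputable section

namespace MinTime

variable {E : Type*} [NormedAddCommGroup E] [InnerProductSpace ℝ E]

/-- The Fréchet normal cone to `Ω` at a point `a` of `Ω`: all `v` such that
`⟨v, x - a⟩ ≤ o(‖x - a‖)` as `x → a` within `Ω`. -/
def frechetNormalCone (Ω : Set E) (a : E) : Set E :=
  {v | ∀ ε : ℝ, 0 < ε → ∀ᶠ x in 𝓝[Ω] a, inner ℝ v (x - a) ≤ ε * ‖x - a‖}

/-- The limiting (Mordukhovich) normal cone to `Ω` at a point `a` of `Ω`: all limits of
Fréchet normals at points of `Ω` that converge to `a`. -/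
def limitingNormalCone (Ω : Set E) (a : E) : Set E :=
  {v | ∃ (x w : ℕ → E), (∀ k, x k ∈ Ω) ∧ Tendsto x atTop (𝓝 a) ∧
    (∀ k, w k ∈ frechetNormalCone Ω (x k)) ∧ Tendsto w atTop (𝓝 v)}

/-- The set `F⁺` of all `v` with `⟨v, x⟩ ≥ 0` for every `x ∈ F`. -/
def positivePolar (F : Set E) : Set E :=
  {v | ∀ x ∈ F, 0 ≤ inner ℝ v x}

/-- The minimal time function with dynamic `F` and target `Ω`, as an extended real-valued
function: the infimum of all real `t ≥ 0` such that `x + tF` meets `Ω`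
(it is `⊤` where there is no such `t`). -/
def minimalTime (F Ω : Set E) (x : E) : EReal :=
  sInf ((fun t : ℝ => (t : EReal)) '' {t : ℝ | 0 ≤ t ∧ ((x +ᵥ t • F) ∩ Ω).Nonempty})

/-- An extended real-valued function is Lipschitz continuous around `a` if, on some
neighbourhood of `a`, it is finite and Lipschitz with some constant. -/
def LipschitzAround (ψ : E → EReal) (a : E) : Prop :=
  ∃ (ℓ : ℝ), ∃ V ∈ 𝓝 a, (∀ x ∈ V, ψ x ≠ ⊤ ∧ ψ x ≠ ⊥) ∧
    ∀ x ∈ V, ∀ u ∈ V, |(ψ x).toReal - (ψ u).toReal| ≤ ℓ * ‖x - u‖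

end MinTime

end

/-!
Both implications rest on first-order estimates for the Fréchet normals of `Ω` near `y`.

If `N(y; Ω) ∩ F⁺ = {0}`, compactness of the unit sphere gives a uniform version of this condition:
there is `α > 0` such that each Fréchet normal `v` at a point of `Ω` near `y` satisfies
`⟨v, f⟩ ≤ -α ‖v‖` for some `f ∈ F` (`exists_uniform_descent`). Given `z` near `y`, minimize
`dist (z + t f, Ω) + (α / 2) t` over `t ≥ 0` and `f ∈ F`. Were the distance positive at a minimizer,
the vector from a projection on `Ω` to `z + t f` would be a Fréchet normal, and moving along the
`f' ∈ F` supplied by the uniform condition would decrease the distance at a rate of at least `α`,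
against a cost of `α / 2`; convexity of `F` keeps the perturbed point of the form
`z + (t + s) f''`. Hence the minimizer reaches `Ω`, in a time at most `(2 / α) dist (z, Ω)`
(`exists_linear_time_bound`). By convexity of `F` again, travel times add up, and this linear bound
becomes a Lipschitz estimate (`lipschitzAround_of_linear_time_bound`).

Conversely, if the minimal time is Lipschitz, then a point `a + s h` with `a ∈ Ω` can be steered into
`Ω` in a time of order `s`. Inserting the point reached in the inequality that defines a Fréchet
normal `w` at `a` yields `⟨w, h⟩ ≤ ℓ ‖h‖ M ‖w - v‖` for every `v ∈ F⁺`, where `M` bounds `F`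
(`inner_le_of_mem_frechetNormalCone`). If normals `w` converge to `v`, this gives `⟨v, v⟩ ≤ 0`.
-/

open Metric

namespace MinTime

section General

variable {E : Type*} [NormedAddCommGroup E] [InnerProductSpace ℝ E] {F Ω : Set E}

/-! ### Travel times -/

/-- The set of times `t ≥ 0` in which `Ω` can be reached from `x` with dynamic `F`; the minimal time
is its infimum in `EReal`. -/
def travelTimes (F Ω : Set E) (x : E) : Set ℝ :=
  {t | 0 ≤ t ∧ ∃ f ∈ F, x + t • f ∈ Ω}

theorem minimalTime_eq (F Ω : Set E) (x : E) :
    minimalTime F Ω x = sInf ((fun t : ℝ => (t : EReal)) '' travelTimes F Ω x) := by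
  unfold minimalTime travelTimes
  congr 2
  ext t
  refine and_congr_right fun _ => ?_
  constructor
  · rintro ⟨_, ⟨_, ⟨f, hf, rfl⟩, rfl⟩, h⟩
    exact ⟨f, hf, h⟩
  · rintro ⟨f, hf, h⟩
    exact ⟨_, ⟨_, ⟨f, hf, rfl⟩, rfl⟩, h⟩

theorem minimalTime_le {x : E} {t : ℝ} (ht : t ∈ travelTimes F Ω x) :
    minimalTime F Ω x ≤ t := by
  rw [minimalTime_eq]
  exact sInf_le ⟨t, ht, rfl⟩

theorem minimalTime_nonneg (F Ω : Set E) (x : E) : 0 ≤ minimalTime F Ω x := by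
  rw [minimalTime_eq]
  refine le_sInf ?_
  rintro _ ⟨t, ht, rfl⟩
  exact EReal.coe_nonneg.2 ht.1

theorem exists_mem_travelTimes_lt {x : E} {c : ℝ} (h : minimalTime F Ω x < c) :
    ∃ t ∈ travelTimes F Ω x, t < c := by
  rw [minimalTime_eq, sInf_lt_iff] at h
  obtain ⟨_, ⟨t, ht, rfl⟩, htc⟩ := h
  exact ⟨t, ht, EReal.coe_lt_coe_iff.1 htc⟩

theorem minimalTime_ne_bot (F Ω : Set E) (x : E) : minimalTime F Ω x ≠ ⊥ := fun h => by
  simpa [h] using minimalTime_nonneg F Ω x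

theorem minimalTime_ne_top {x : E} {t : ℝ} (ht : t ∈ travelTimes F Ω x) :
    minimalTime F Ω x ≠ ⊤ :=
  ((minimalTime_le ht).trans_lt (EReal.coe_lt_top t)).ne

theorem minimalTime_eq_zero (hF : F.Nonempty) {x : E} (hx : x ∈ Ω) : minimalTime F Ω x = 0 := by
  obtain ⟨f, hf⟩ := hF
  have h0 : (0 : ℝ) ∈ travelTimes F Ω x := ⟨le_rfl, f, hf, by simpa using hx⟩
  exact le_antisymm (by simpa using minimalTime_le h0) (minimalTime_nonneg F Ω x)

theorem exists_add_smul_eq (hF : Convex ℝ F) {s t : ℝ} (hs : 0 ≤ s) (ht : 0 ≤ t) {f g : E}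
    (hf : f ∈ F) (hg : g ∈ F) : ∃ k ∈ F, (s + t) • k = s • f + t • g := by
  have h : s • f + t • g ∈ (s + t) • F := by
    rw [hF.add_smul hs ht]
    exact Set.add_mem_add (Set.smul_mem_smul_set hf) (Set.smul_mem_smul_set hg)
  exact h

theorem add_mem_travelTimes (hF : Convex ℝ F) {x f : E} {s t : ℝ} (ht : 0 ≤ t) (hf : f ∈ F)
    (hs : s ∈ travelTimes F Ω (x + t • f)) : t + s ∈ travelTimes F Ω x := by
  obtain ⟨hs0, g, hg, hmem⟩ := hs
  obtain ⟨k, hk, hkeq⟩ := exists_add_smul_eq hF ht hs0 hf hg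
  exact ⟨add_nonneg ht hs0, k, hk, by rwa [hkeq, ← add_assoc]⟩

/-- If `Ω` can be reached from every point near `y ∈ Ω` in a time linear in the distance to `Ω`, then
the minimal time is Lipschitz around `y`. From `x` one copies a nearly optimal trajectory of `u`, and
arrives at distance at most `‖x - u‖` from `Ω`. -/
theorem lipschitzAround_of_linear_time_bound (hF : Convex ℝ F) {M : ℝ} (hM0 : 0 < M)
    (hM : ∀ f ∈ F, ‖f‖ ≤ M) {y : E} (hy : y ∈ Ω) {ℓ r : ℝ} (hℓ : 0 < ℓ) (hr : 0 < r)
    (H : ∀ z ∈ ball y r, ∃ t ∈ travelTimes F Ω z, t ≤ ℓ * infDist z Ω) :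
    LipschitzAround (minimalTime F Ω) y := by
  -- From `u ∈ ball y ρ`, the target is reached in time `< ℓ * ρ`; the choice of `ρ` keeps the
  -- trajectories of that duration which start in `ball y ρ` inside `ball y r`.
  set ρ : ℝ := r / (1 + ℓ * M) with hρdef
  have hden : 0 < 1 + ℓ * M := by positivity
  have hρ : 0 < ρ := by positivity
  have hρr : ρ + ℓ * ρ * M = r := by rw [hρdef]; field_simp
  have hsub : ∀ u ∈ ball y ρ, u ∈ ball y r := fun u hu =>
    ball_subset_ball (by nlinarith [mul_pos (mul_pos hℓ hρ) hM0]) hu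
  have hfin : ∀ u ∈ ball y ρ, minimalTime F Ω u ≠ ⊤ := fun u hu => by
    obtain ⟨t, ht, -⟩ := H u (hsub u hu)
    exact minimalTime_ne_top ht
  have key : ∀ x ∈ ball y ρ, ∀ u ∈ ball y ρ,
      (minimalTime F Ω x).toReal ≤ (minimalTime F Ω u).toReal + ℓ * ‖x - u‖ := by
    intro x hx u hu
    have hxr := EReal.coe_toReal (hfin x hx) (minimalTime_ne_bot F Ω x)
    have hur := EReal.coe_toReal (hfin u hu) (minimalTime_ne_bot F Ω u)
    set a := (minimalTime F Ω x).toReal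
    set b := (minimalTime F Ω u).toReal
    have hb : b < ℓ * ρ := by
      obtain ⟨t, ht, htle⟩ := H u (hsub u hu)
      have h1 : b ≤ t := EReal.coe_le_coe_iff.1 (hur ▸ minimalTime_le ht)
      have h2 : infDist u Ω < ρ := (infDist_le_dist_of_mem hy).trans_lt hu
      nlinarith
    refine le_of_forall_pos_le_add fun ε hε => ?_
    obtain ⟨t, ⟨ht0, f, hf, hmem⟩, htlt⟩ :=
      exists_mem_travelTimes_lt (F := F) (Ω := Ω) (x := u) (c := min (b + ε) (ℓ * ρ))
        (by rw [← hur]; exact EReal.coe_lt_coe_iff.2 (lt_min (by linarith) hb))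
    have hz : x + t • f ∈ ball y r := by
      rw [mem_ball, dist_eq_norm]
      have h1 : ‖x - y‖ < ρ := by simpa [dist_eq_norm] using hx
      have h2 : ‖t • f‖ ≤ ℓ * ρ * M := by
        rw [norm_smul, Real.norm_of_nonneg ht0]
        exact mul_le_mul (htlt.le.trans (min_le_right _ _)) (hM f hf) (norm_nonneg _)
          (by positivity)
      calc ‖x + t • f - y‖ = ‖(x - y) + t • f‖ := by congr 1; abel
        _ ≤ ‖x - y‖ + ‖t • f‖ := norm_add_le _ _
        _ < r := by linarith
    obtain ⟨s, hs, hsle⟩ := H _ hz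
    have hd : infDist (x + t • f) Ω ≤ ‖x - u‖ := by
      refine (infDist_le_dist_of_mem hmem).trans_eq ?_
      rw [dist_eq_norm]; congr 1; abel
    have h1 : a ≤ t + s :=
      EReal.coe_le_coe_iff.1 (hxr ▸ minimalTime_le (add_mem_travelTimes hF ht0 hf hs))
    have h2 : t < b + ε := htlt.trans_le (min_le_left _ _)
    nlinarith
  refine ⟨ℓ, ball y ρ, ball_mem_nhds y hρ,
    fun x hx => ⟨hfin x hx, minimalTime_ne_bot F Ω x⟩, fun x hx u hu => ?_⟩
  have h1 := key x hx u hu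
  have h2 := key u hu x hx
  rw [norm_sub_rev] at h2
  exact abs_le.2 ⟨by linarith, by linarith⟩

/-! ### Fréchet normals -/

theorem smul_mem_frechetNormalCone {a v : E} (hv : v ∈ frechetNormalCone Ω a) {c : ℝ}
    (hc : 0 < c) : c • v ∈ frechetNormalCone Ω a := by
  intro ε hε
  filter_upwards [hv (ε / c) (by positivity)] with x hx
  rw [real_inner_smul_left]
  calc c * inner ℝ v (x - a) ≤ c * (ε / c * ‖x - a‖) := by gcongr
    _ = ε * ‖x - a‖ := by field_simp

theorem zero_mem_frechetNormalCone (Ω : Set E) (a : E) : 0 ∈ frechetNormalCone Ω a := by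
  intro ε hε
  filter_upwards with x
  rw [inner_zero_left]
  positivity

/-- Proximal normals are Fréchet normals. -/
theorem sub_mem_frechetNormalCone {z p : E} (hp : ∀ x ∈ Ω, ‖z - p‖ ≤ ‖z - x‖) :
    z - p ∈ frechetNormalCone Ω p := by
  intro ε hε
  have hball : ball p ε ∈ 𝓝[Ω] p := mem_nhdsWithin_of_mem_nhds (ball_mem_nhds p hε)
  filter_upwards [hball, self_mem_nhdsWithin] with x hx hxΩ
  have hx' : ‖x - p‖ < ε := by simpa [dist_eq_norm] using hx
  have h1 := hp x hxΩ
  have h2 : ‖z - x‖ ^ 2 = ‖z - p‖ ^ 2 - 2 * inner ℝ (z - p) (x - p) + ‖x - p‖ ^ 2 := by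
    rw [← norm_sub_sq_real]; congr 2; abel
  have h3 : ‖z - p‖ ^ 2 ≤ ‖z - x‖ ^ 2 := by gcongr
  nlinarith [norm_nonneg (x - p)]

/-- The limit of normalized Fréchet normals along which the polarity with `F` degenerates would be a
unit vector of `N(y; Ω) ∩ F⁺`. -/
theorem exists_uniform_descent [FiniteDimensional ℝ E] (hF : F.Nonempty) {y : E}
    (h : limitingNormalCone Ω y ∩ positivePolar F = {0}) :
    ∃ α > 0, ∃ r > 0, ∀ p ∈ Ω, p ∈ ball y r → ∀ v ∈ frechetNormalCone Ω p,
      ∃ f ∈ F, inner ℝ v f ≤ -α * ‖v‖ := by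
  by_contra! hcon
  have hpos : ∀ k : ℕ, (0 : ℝ) < 1 / ((k : ℝ) + 1) := fun k => Nat.one_div_pos_of_nat
  choose p hpΩ hpb v hv hvF using fun k : ℕ => hcon _ (hpos k) _ (hpos k)
  have hv0 : ∀ k, 0 < ‖v k‖ := by
    intro k
    obtain ⟨f, hf⟩ := hF
    refine norm_pos_iff.2 fun h0 => ?_
    simpa [h0] using hvF k f hf
  set w : ℕ → E := fun k => ‖v k‖⁻¹ • v k with hw
  have hwS : ∀ k, w k ∈ sphere (0 : E) 1 := fun k => by
    simp [hw, norm_smul, (hv0 k).ne']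
  obtain ⟨w₀, hw₀, φ, hφ, hlim⟩ := (isCompact_sphere (0 : E) 1).tendsto_subseq hwS
  have hinv : Tendsto (fun k : ℕ => 1 / ((k : ℝ) + 1)) atTop (𝓝 0) :=
    tendsto_one_div_add_atTop_nhds_zero_nat
  have hp : Tendsto p atTop (𝓝 y) := by
    rw [tendsto_iff_dist_tendsto_zero]
    exact squeeze_zero (fun _ => dist_nonneg) (fun k => (hpb k).le) hinv
  have hmem : w₀ ∈ limitingNormalCone Ω y ∩ positivePolar F := by
    refine ⟨⟨p ∘ φ, w ∘ φ, fun k => hpΩ _, hp.comp hφ.tendsto_atTop,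
      fun k => smul_mem_frechetNormalCone (hv _) (inv_pos.2 (hv0 _)), hlim⟩, fun f hf => ?_⟩
    have h1 : Tendsto (fun k => inner ℝ (w (φ k)) f) atTop (𝓝 (inner ℝ w₀ f)) :=
      hlim.inner tendsto_const_nhds
    have h2 : Tendsto (fun k => -(1 / ((φ k : ℝ) + 1))) atTop (𝓝 0) := by
      simpa using (hinv.comp hφ.tendsto_atTop).neg
    refine le_of_tendsto_of_tendsto' h2 h1 fun k => ?_
    have h3 := (hvF (φ k) f hf).le
    simp only [hw, real_inner_smul_left]
    rw [inv_mul_eq_div, le_div_iff₀ (hv0 _)]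
    exact h3
  rw [h, Set.mem_singleton_iff] at hmem
  simp [hmem] at hw₀

/-! ### Linear bound on the travel time -/

/-- A minimizer of `dist (z + t f, Ω) + (α / 2) t` reaches `Ω`. -/
theorem exists_linear_time_bound [FiniteDimensional ℝ E] (hFne : F.Nonempty)
    (hFc : IsCompact F) (hF : Convex ℝ F) {M : ℝ} (hM0 : 0 < M) (hM : ∀ f ∈ F, ‖f‖ ≤ M)
    (hΩ : IsClosed Ω) {y : E} (hy : y ∈ Ω) {α r : ℝ} (hα : 0 < α) (hr : 0 < r)
    (h : ∀ p ∈ Ω, p ∈ ball y r → ∀ v ∈ frechetNormalCone Ω p,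
      ∃ f ∈ F, inner ℝ v f ≤ -α * ‖v‖) :
    ∃ ρ > 0, ∀ z ∈ ball y ρ, ∃ t ∈ travelTimes F Ω z, t ≤ 2 / α * infDist z Ω := by
  have hΩne : Ω.Nonempty := ⟨y, hy⟩
  refine ⟨r / (2 + 2 / α * M), by positivity, fun z hz => ?_⟩
  have hzy : (2 + 2 / α * M) * ‖z - y‖ < r := by
    rw [mem_ball, dist_eq_norm, lt_div_iff₀ (by positivity)] at hz
    linarith
  set D := infDist z Ω
  have hD0 : 0 ≤ D := infDist_nonneg
  have hDy : D ≤ ‖z - y‖ := by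
    rw [← dist_eq_norm]; exact infDist_le_dist_of_mem hy
  -- Minimizers have `t ≤ 2 / α * D`; the extra `1` leaves room to increase `t`.
  set T := 2 / α * D + 1
  have hT0 : 0 ≤ T := by positivity
  obtain ⟨⟨t, f⟩, ⟨⟨ht0, htT⟩, hf⟩, hmin⟩ :=
    ((isCompact_Icc (a := (0 : ℝ)) (b := T)).prod hFc).exists_isMinOn
      ((Set.nonempty_Icc.2 hT0).prod hFne)
      (f := fun q : ℝ × E => infDist (z + q.1 • q.2) Ω + α / 2 * q.1)
      (by
        refine Continuous.continuousOn ?_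
        exact ((continuous_infDist_pt Ω).comp (by fun_prop)).add (by fun_prop))
  dsimp only at ht0 htT hf
  have hmin' : ∀ s ∈ Set.Icc 0 T, ∀ g ∈ F,
      infDist (z + t • f) Ω + α / 2 * t ≤ infDist (z + s • g) Ω + α / 2 * s :=
    fun s hs g hg => isMinOn_iff.1 hmin (s, g) ⟨hs, hg⟩
  have hle : infDist (z + t • f) Ω + α / 2 * t ≤ D := by
    simpa using hmin' 0 ⟨le_rfl, hT0⟩ f hf
  have htle : t ≤ 2 / α * D := by
    have h1 : α / 2 * t ≤ D := by linarith [infDist_nonneg (x := z + t • f) (s := Ω)]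
    calc t = 2 / α * (α / 2 * t) := by field_simp
      _ ≤ 2 / α * D := by gcongr
  refine ⟨t, ⟨ht0, f, hf, ?_⟩, htle⟩
  obtain ⟨p, hpΩ, hpd⟩ := hΩ.exists_infDist_eq_dist hΩne (z + t • f)
  rw [dist_eq_norm] at hpd
  set d := z + t • f - p with hd
  have hpball : p ∈ ball y r := by
    have h1 : ‖t • f‖ ≤ 2 / α * ‖z - y‖ * M := by
      rw [norm_smul, Real.norm_of_nonneg ht0]
      exact mul_le_mul (htle.trans (by gcongr)) (hM f hf) (norm_nonneg _) (by positivity)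
    have h2 : ‖d‖ ≤ ‖z - y‖ := by
      rw [← hpd]
      have : 0 ≤ α / 2 * t := by positivity
      linarith
    rw [mem_ball, dist_eq_norm]
    calc ‖p - y‖ = ‖((z - y) + t • f) - d‖ := by congr 1; rw [hd]; abel
      _ ≤ ‖z - y‖ + ‖t • f‖ + ‖d‖ :=
        (norm_sub_le _ _).trans (add_le_add (norm_add_le _ _) le_rfl)
      _ < r := by linarith
  have hnormal : d ∈ frechetNormalCone Ω p := by
    refine sub_mem_frechetNormalCone fun x hx => ?_
    rw [← hd, ← hpd, ← dist_eq_norm]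
    exact infDist_le_dist_of_mem hx
  obtain ⟨g, hg, hgd⟩ := h p hpΩ hpball d hnormal
  suffices hd0 : d = 0 by
    have : z + t • f = p := sub_eq_zero.1 hd0
    rwa [this]
  by_contra hd0
  have hdpos : 0 < ‖d‖ := norm_pos_iff.2 hd0
  -- For a small step `s` along `g`, comparing `‖d + s g‖²` with `(‖d‖ - α s / 2)²` forces
  -- `α ‖d‖ ≤ s M²`; the three bounds on `s` keep `t + s ≤ T` and `α s / 2 ≤ ‖d‖`, and refute this.
  obtain ⟨s, hs0, hs1, hs2, hs3⟩ :
      ∃ s : ℝ, 0 < s ∧ s ≤ 1 ∧ α / 2 * s ≤ ‖d‖ ∧ s * M ^ 2 < α * ‖d‖ := by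
    refine ⟨min 1 (min (2 * ‖d‖ / α) (α * ‖d‖ / (2 * M ^ 2))), by positivity,
      min_le_left _ _, ?_, ?_⟩
    · calc _ ≤ α / 2 * (2 * ‖d‖ / α) := by
            gcongr; exact (min_le_right _ _).trans (min_le_left _ _)
        _ = ‖d‖ := by field_simp
    · calc _ ≤ α * ‖d‖ / (2 * M ^ 2) * M ^ 2 := by
            gcongr; exact (min_le_right _ _).trans (min_le_right _ _)
        _ = α * ‖d‖ / 2 := by field_simp
        _ < α * ‖d‖ := half_lt_self (by positivity)
  obtain ⟨k, hk, hkeq⟩ := exists_add_smul_eq hF ht0 hs0.le hf hg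
  have h1 := hmin' (t + s) ⟨by linarith, by linarith⟩ k hk
  have h2 : infDist (z + (t + s) • k) Ω ≤ ‖d + s • g‖ := by
    refine (infDist_le_dist_of_mem hpΩ).trans_eq ?_
    rw [dist_eq_norm, hkeq, hd]; congr 1; abel
  have h3 : ‖d‖ - α / 2 * s ≤ ‖d + s • g‖ := by
    rw [hpd] at h1; linarith
  have h4 : (‖d‖ - α / 2 * s) ^ 2 ≤ ‖d + s • g‖ ^ 2 :=
    pow_le_pow_left₀ (by linarith) h3 2
  have h5 : ‖s • g‖ ^ 2 ≤ s ^ 2 * M ^ 2 := by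
    rw [norm_smul, Real.norm_of_nonneg hs0.le, mul_pow]
    gcongr
    exact hM g hg
  rw [norm_add_sq_real, real_inner_smul_right] at h4
  have h6 : s * (α * ‖d‖) ≤ s * (s * M ^ 2) := by
    nlinarith [mul_le_mul_of_nonneg_left hgd hs0.le, sq_nonneg (α / 2 * s)]
  exact absurd (le_of_mul_le_mul_left h6 hs0) (not_le.2 hs3)

/-! ### Normals under a Lipschitz minimal time -/

/-- For `a ∈ Ω`, some point `a + s h + t f` with `f ∈ F` and `t` at most about `ℓ s ‖h‖` lies in `Ω`;
it is tested against the Fréchet normal `w`, with `⟨w, f⟩ ≥ -M ‖w - v‖` because `v ∈ F⁺`. -/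
theorem inner_le_of_mem_frechetNormalCone (hF : F.Nonempty) {M : ℝ} (hM0 : 0 < M)
    (hM : ∀ f ∈ F, ‖f‖ ≤ M) {ℓ : ℝ} {V : Set E} {a : E} (hV : V ∈ 𝓝 a)
    (hfin : ∀ x ∈ V, minimalTime F Ω x ≠ ⊤ ∧ minimalTime F Ω x ≠ ⊥)
    (hLip : ∀ x ∈ V, ∀ u ∈ V,
      |(minimalTime F Ω x).toReal - (minimalTime F Ω u).toReal| ≤ ℓ * ‖x - u‖)
    (ha : a ∈ Ω) {v w : E} (hv : v ∈ positivePolar F) (hw : w ∈ frechetNormalCone Ω a) (h : E) :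
    inner ℝ w h ≤ ℓ * ‖h‖ * (M * ‖w - v‖) := by
  have key : ∀ ε > 0, inner ℝ w h ≤
      ε * (‖h‖ + (ℓ * ‖h‖ + ε) * M) + (ℓ * ‖h‖ + ε) * (M * ‖w - v‖) := by
    intro ε hε
    set A := ℓ * ‖h‖ + ε
    obtain ⟨δ, hδ, hwδ⟩ := Metric.mem_nhdsWithin_iff.1 (hw ε hε)
    have hcont : Tendsto (fun s : ℝ => a + s • h) (𝓝[>] 0) (𝓝 a) := by
      have : Tendsto (fun s : ℝ => a + s • h) (𝓝 0) (𝓝 (a + (0 : ℝ) • h)) :=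
        Continuous.tendsto (by fun_prop) 0
      rw [zero_smul, add_zero] at this
      exact this.mono_left nhdsWithin_le_nhds
    have hsmall : Tendsto (fun s : ℝ => s * (‖h‖ + A * M)) (𝓝[>] 0) (𝓝 0) := by
      have : Tendsto (fun s : ℝ => s * (‖h‖ + A * M)) (𝓝 0) (𝓝 (0 * (‖h‖ + A * M))) :=
        Continuous.tendsto (by fun_prop) 0
      rw [zero_mul] at this
      exact this.mono_left nhdsWithin_le_nhds
    obtain ⟨s, hsV, hsδ, hs0⟩ :=
      ((hcont.eventually hV).and ((hsmall.eventually (gt_mem_nhds hδ)).and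
        self_mem_nhdsWithin)).exists
    replace hs0 : 0 < s := hs0
    have hlt : minimalTime F Ω (a + s • h) < ((s * A : ℝ) : EReal) := by
      rw [← EReal.coe_toReal (hfin _ hsV).1 (hfin _ hsV).2, EReal.coe_lt_coe_iff]
      have h1 := (le_abs_self _).trans (hLip _ hsV a (mem_of_mem_nhds hV))
      rw [minimalTime_eq_zero hF ha, EReal.toReal_zero, sub_zero, add_sub_cancel_left,
        norm_smul, Real.norm_of_nonneg hs0.le] at h1
      nlinarith [mul_pos hs0 hε]
    obtain ⟨t, ⟨ht0, f, hf, hmem⟩, htA⟩ := exists_mem_travelTimes_lt hlt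
    have hsub : a + s • h + t • f - a = s • h + t • f := by abel
    have hnorm : ‖s • h + t • f‖ ≤ s * (‖h‖ + A * M) := by
      refine (norm_add_le _ _).trans ?_
      rw [norm_smul, norm_smul, Real.norm_of_nonneg hs0.le, Real.norm_of_nonneg ht0]
      nlinarith [mul_le_mul htA.le (hM f hf) (norm_nonneg f) (ht0.trans htA.le)]
    have hball : a + s • h + t • f ∈ ball a δ := by
      rw [mem_ball, dist_eq_norm, hsub]
      exact hnorm.trans_lt hsδ
    have hineq : inner ℝ w (a + s • h + t • f - a) ≤ ε * ‖a + s • h + t • f - a‖ :=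
      hwδ ⟨hball, hmem⟩
    rw [hsub, inner_add_right, real_inner_smul_right, real_inner_smul_right] at hineq
    have hwf : -(M * ‖w - v‖) ≤ inner ℝ w f := by
      have h1 := (abs_le.1 (abs_real_inner_le_norm (w - v) f)).1
      have h2 := mul_le_mul_of_nonneg_left (hM f hf) (norm_nonneg (w - v))
      rw [inner_sub_left] at h1
      linarith [hv f hf]
    have h3 : t * -(M * ‖w - v‖) ≤ t * inner ℝ w f := mul_le_mul_of_nonneg_left hwf ht0
    have h4 : t * (M * ‖w - v‖) ≤ s * A * (M * ‖w - v‖) :=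
      mul_le_mul_of_nonneg_right htA.le (by positivity)
    have h5 := mul_le_mul_of_nonneg_left hnorm hε.le
    refine le_of_mul_le_mul_left ?_ hs0
    linarith
  have hlim : Tendsto (fun ε : ℝ => ε * (‖h‖ + (ℓ * ‖h‖ + ε) * M)
      + (ℓ * ‖h‖ + ε) * (M * ‖w - v‖)) (𝓝[>] 0) (𝓝 (ℓ * ‖h‖ * (M * ‖w - v‖))) := by
    have : Tendsto (fun ε : ℝ => ε * (‖h‖ + (ℓ * ‖h‖ + ε) * M)
        + (ℓ * ‖h‖ + ε) * (M * ‖w - v‖)) (𝓝 0)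
        (𝓝 (0 * (‖h‖ + (ℓ * ‖h‖ + 0) * M) + (ℓ * ‖h‖ + 0) * (M * ‖w - v‖))) :=
      Continuous.tendsto (by fun_prop) 0
    rw [zero_mul, zero_add, add_zero] at this
    exact this.mono_left nhdsWithin_le_nhds
  refine ge_of_tendsto hlim ?_
  filter_upwards [self_mem_nhdsWithin] with ε hε using key ε hε

theorem limitingNormalCone_inter_positivePolar_eq (hF : F.Nonempty) {M : ℝ} (hM0 : 0 < M)
    (hM : ∀ f ∈ F, ‖f‖ ≤ M) {y : E} (hy : y ∈ Ω)
    (hLip : LipschitzAround (minimalTime F Ω) y) :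
    limitingNormalCone Ω y ∩ positivePolar F = {0} := by
  obtain ⟨ℓ, V, hV, hfin, hLip⟩ := hLip
  refine Set.eq_singleton_iff_unique_mem.2 ⟨⟨?_, fun f _ => by simp⟩, ?_⟩
  · exact ⟨fun _ => y, fun _ => 0, fun _ => hy, tendsto_const_nhds,
      fun _ => zero_mem_frechetNormalCone Ω y, tendsto_const_nhds⟩
  rintro v ⟨⟨x, w, hxΩ, hx, hw, hwv⟩, hv⟩
  have hbound : ∀ᶠ k in atTop, inner ℝ (w k) v ≤ ℓ * ‖v‖ * (M * ‖w k - v‖) := by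
    filter_upwards [hx.eventually (eventually_mem_nhds_iff.2 hV)] with k hk
    exact inner_le_of_mem_frechetNormalCone hF hM0 hM hk hfin hLip (hxΩ k) hv (hw k) v
  have h1 : Tendsto (fun k => inner ℝ (w k) v) atTop (𝓝 (inner ℝ v v)) :=
    hwv.inner tendsto_const_nhds
  have h2 : Tendsto (fun k => ℓ * ‖v‖ * (M * ‖w k - v‖)) atTop (𝓝 0) := by
    simpa using ((tendsto_iff_norm_sub_tendsto_zero.1 hwv).const_mul M).const_mul (ℓ * ‖v‖)
  have h3 := le_of_tendsto_of_tendsto h1 h2 hbound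
  rw [real_inner_self_eq_norm_sq] at h3
  exact norm_eq_zero.1 (sq_eq_zero_iff.1 (le_antisymm h3 (sq_nonneg _)))

end General

end MinTime

theorem corollary3p6 (n : ℕ) (F Ω : Set (EuclideanSpace ℝ (Fin n)))
    (hF_nonempty : F.Nonempty) (hF_closed : IsClosed F)
    (hF_bounded : Bornology.IsBounded F) (hF_convex : Convex ℝ F)
    (hΩ_closed : IsClosed Ω) (y : EuclideanSpace ℝ (Fin n)) (hy : y ∈ Ω) :
    (MinTime.limitingNormalCone Ω y ∩ MinTime.positivePolar F = {0} →
      MinTime.LipschitzAround (MinTime.minimalTime F Ω) y) ∧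
    ((0 : EuclideanSpace ℝ (Fin n)) ∈ F →
      MinTime.LipschitzAround (MinTime.minimalTime F Ω) y →
      MinTime.limitingNormalCone Ω y ∩ MinTime.positivePolar F = {0}) := by
  obtain ⟨M, hM0, hM⟩ := hF_bounded.exists_pos_norm_le
  refine ⟨fun h => ?_, fun _ hLip =>
    MinTime.limitingNormalCone_inter_positivePolar_eq hF_nonempty hM0 hM hy hLip⟩
  obtain ⟨α, hα, r, hr, hdesc⟩ := MinTime.exists_uniform_descent hF_nonempty h
  obtain ⟨ρ, hρ, hbound⟩ := MinTime.exists_linear_time_bound hF_nonempty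
    (Metric.isCompact_of_isClosed_isBounded hF_closed hF_bounded) hF_convex hM0 hM
    hΩ_closed hy hα hr hdesc
  exact MinTime.lipschitzAround_of_linear_time_bound hF_convex hM0 hM hy (by positivity) hρ hbound
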